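/- Let $\tau\in\mathbb{C}$ with $\operatorname{Im}\tau>0$ and put $q=e^{2\pi i\tau}$. Let $\eta(\tau)=e^{2\pi i\tau/24}\prod_{n=1}^{\infty}(1-q^n)$ be the Dedekind eta function. For an integer $n$ let $\left(\frac{n}{3}\right)=1,-1,0$ according as $n\equiv 1,-1,0\pmod 3$. For positive integers $j,k,n$ let $d^{*}_{j,k}(n)$ be the number of positive divisors $d$ of $n$ such that $d\equiv j\pmod k$ and $n/d$ is odd. Then, both series being absolutely convergent, $$\frac{\eta^2(\tau)\,\eta^2(4\tau)}{\eta(2\tau)}=\sum_{n=1}^{\infty} n\left(\frac{n}{3}\right)\exp\left(\frac{2\pi i n^2\tau}{3}\right)$$ and $$\frac{\eta(2\tau)\,\eta^3(3\tau)\,\eta^3(12\tau)}{\eta(\tau)\,\eta(4\tau)\,\eta^3(6\tau)}=\sum_{n=1}^{\infty}\left(d^{*}_{1,6}(n)+d^{*}_{2,6}(n)-d^{*}_{4,6}(n)-d^{*}_{5,6}(n)\right)q^n .$$ -/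

import Mathlib

/-- `dStar j k n` is the number of positive divisors `d` of `n` such that `d ≡ j (mod k)`
and `n / d` is odd. -/
def dStar (j k n : ℕ) : ℕ :=
  (n.divisors.filter fun d => d ≡ j [MOD k] ∧ Odd (n / d)).card

/-- The symbol `(n / 3)`: `1` if `n ≡ 1`, `-1` if `n ≡ -1`, and `0` if `n ≡ 0` modulo `3`. -/
def symbolThree (n : ℤ) : ℤ :=
  if n ≡ 1 [ZMOD 3] then 1 else if n ≡ -1 [ZMOD 3] then -1 else 0

/-! Write E(q) for `eulerProd q`. Both identities come from bilateral sums obtained as limits of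
finite identities, the passage to the limit being a Tannery argument (`tendsto_sum_mul_mul`).

First identity: put X = e^{2πiτ/6}, and multiply the series of u(u/3)X^{2u²} over all integers u by
the pentagonal series of `signFour v` (v/3)X^{v²}, whose value is 2X E(X^24). Since (v/3)(u/3) is
the difference of the indicators of 3 ∣ v - u and 3 ∣ v + u, the double sum lives on two sublattices
exchanged by u ↦ -u. On the second, v = s + 2t and u = t - s give v² + 2u² = 3s² + 6t², and the
variables separate: what survives is Jacobi's series for E³ times an alternating theta series
(`hasSum_sublattice`). Dividing by 2X E(X^24) gives the eta quotient (`hasSum_mul_symbolThree_int`).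

Second identity: Kronecker's sum of x^k/(1 - aQ^k) at a = -q³, x = q², Q = q⁶ has the required
product as its value (`hasSum_odd_int`). Pairing k = n with k = -(n+1) turns it into a Lambert
series over odd exponents, and expanding that series counts divisors (`hasSum_dStar`). -/

open Filter Topology Finset

/-! ### Finite and infinite q-Pochhammer symbols. -/

/-- The finite `q`-Pochhammer symbol `∏_{i < m} (1 - a Q ^ i)`. -/
def qFin (a Q : ℂ) (m : ℕ) : ℂ := ∏ i ∈ range m, (1 - a * Q ^ i)

/-- The infinite `q`-Pochhammer symbol `∏_{i ≥ 0} (1 - a Q ^ i)`. -/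
noncomputable def qInf (a Q : ℂ) : ℂ := ∏' i : ℕ, (1 - a * Q ^ i)

lemma qFin_zero (a Q : ℂ) : qFin a Q 0 = 1 := by simp [qFin]

lemma qFin_succ (a Q : ℂ) (m : ℕ) : qFin a Q (m + 1) = qFin a Q m * (1 - a * Q ^ m) := by
  simp [qFin, prod_range_succ]

lemma summable_norm_mul_pow (a : ℂ) {Q : ℂ} (hQ : ‖Q‖ < 1) :
    Summable fun i : ℕ => ‖-(a * Q ^ i)‖ := by
  simpa using (summable_geometric_of_lt_one (norm_nonneg _) hQ).mul_left ‖a‖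

lemma multipliable_one_sub_mul_pow (a : ℂ) {Q : ℂ} (hQ : ‖Q‖ < 1) :
    Multipliable fun i : ℕ => 1 - a * Q ^ i := by
  simpa [sub_eq_add_neg] using multipliable_one_add_of_summable (summable_norm_mul_pow a hQ)

lemma tendsto_qFin (a : ℂ) {Q : ℂ} (hQ : ‖Q‖ < 1) :
    Tendsto (qFin a Q) atTop (𝓝 (qInf a Q)) :=
  (multipliable_one_sub_mul_pow a hQ).hasProd.tendsto_prod_nat

lemma qInf_ne_zero {a Q : ℂ} (hQ : ‖Q‖ < 1) (h : ∀ i : ℕ, 1 - a * Q ^ i ≠ 0) :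
    qInf a Q ≠ 0 := by
  have := tprod_one_add_ne_zero_of_summable (f := fun i : ℕ => -(a * Q ^ i))
    (fun i => by simpa [sub_eq_add_neg] using h i) (summable_norm_mul_pow a hQ)
  simpa [qInf, sub_eq_add_neg] using this

lemma one_sub_ne_zero_of_norm_lt_one {z : ℂ} (h : ‖z‖ < 1) : 1 - z ≠ 0 := by
  intro h0
  rw [← sub_eq_zero.mp h0] at h
  simp at h

lemma norm_mul_pow_lt_one {a Q : ℂ} (ha : ‖a‖ < 1) (hQ : ‖Q‖ < 1) (i : ℕ) :
    ‖a * Q ^ i‖ < 1 := by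
  rw [norm_mul, norm_pow]
  exact (mul_le_of_le_one_right (norm_nonneg _) (pow_le_one₀ (norm_nonneg _) hQ.le)).trans_lt ha

lemma qInf_ne_zero_of_norm_lt_one {a Q : ℂ} (ha : ‖a‖ < 1) (hQ : ‖Q‖ < 1) : qInf a Q ≠ 0 :=
  qInf_ne_zero hQ fun i => one_sub_ne_zero_of_norm_lt_one (norm_mul_pow_lt_one ha hQ i)

lemma qFin_ne_zero_of_norm_lt_one {a Q : ℂ} (ha : ‖a‖ < 1) (hQ : ‖Q‖ < 1) (m : ℕ) :
    qFin a Q m ≠ 0 :=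
  prod_ne_zero_iff.mpr fun i _ => one_sub_ne_zero_of_norm_lt_one (norm_mul_pow_lt_one ha hQ i)

/-! ### The finite triple product and Tannery's theorem. -/

/-- The finite `q`-binomial theorem. -/
lemma qFin_eq_sum {Q : ℂ} (hQ : ‖Q‖ < 1) (w : ℂ) (M : ℕ) :
    qFin w Q M = ∑ j ∈ range (M + 1),
      (-w) ^ j * Q ^ (j.choose 2) * (qFin Q Q M / (qFin Q Q j * qFin Q Q (M - j))) := by
  have hne := qFin_ne_zero_of_norm_lt_one hQ hQ
  induction M with
  | zero => simp [qFin]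
  | succ M ih =>
    -- The q-Pascal rule [M+1, j+1] = [M, j+1] + Q^(M-j) [M, j]; the end terms are peeled off
    -- separately.
    have key : ∀ j ∈ range M, (-w) ^ (j + 1) * Q ^ ((j + 1).choose 2) *
        (qFin Q Q (M + 1) / (qFin Q Q (j + 1) * qFin Q Q (M + 1 - (j + 1)))) =
        (-w) ^ (j + 1) * Q ^ ((j + 1).choose 2) *
          (qFin Q Q M / (qFin Q Q (j + 1) * qFin Q Q (M - (j + 1)))) +
        (-w) ^ j * Q ^ (j.choose 2) * (qFin Q Q M / (qFin Q Q j * qFin Q Q (M - j))) *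
          (-(w * Q ^ M)) := by
      intro j hj
      obtain ⟨k, rfl⟩ : ∃ k, M = j + 1 + k := ⟨M - (j + 1), by have := mem_range.mp hj; omega⟩
      have h1 : j + 1 + k + 1 - (j + 1) = k + 1 := by omega
      have h2 : j + 1 + k - (j + 1) = k := by omega
      have h3 : j + 1 + k - j = k + 1 := by omega
      rw [h1, h2, h3, qFin_succ _ _ (j + 1 + k)]
      have hj1 := hne (j + 1)
      have hk1 := hne (k + 1)
      rw [qFin_succ] at hj1 hk1
      obtain ⟨hj1, hj2⟩ := mul_ne_zero_iff.mp hj1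
      obtain ⟨hk1, hk2⟩ := mul_ne_zero_iff.mp hk1
      have hc : (j + 1).choose 2 = j + j.choose 2 := by
        rw [Nat.choose_succ_succ' j 1, Nat.choose_one_right]
      rw [hc, qFin_succ _ _ j, qFin_succ _ _ k]
      generalize qFin Q Q (j + 1 + k) = P
      field_simp
      ring
    have hc : (M + 1).choose 2 = M + M.choose 2 := by
      rw [Nat.choose_succ_succ' M 1, Nat.choose_one_right]
    rw [sum_range_succ', sum_range_succ (n := M), sum_congr rfl key, sum_add_distrib, ← sum_mul,
      qFin_succ, mul_sub, mul_one]
    nth_rw 1 [ih, sum_range_succ']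
    rw [ih, sum_range_succ (n := M)]
    simp only [qFin_zero, Nat.sub_self, Nat.sub_zero, hc, pow_zero, Nat.choose_zero_succ, mul_one,
      one_mul, div_self (hne _)]
    ring

lemma sum_range_sub_eq_sum_Icc (N : ℕ) (f : ℤ → ℂ) :
    ∑ j ∈ range (2 * N + 1), f ((j : ℤ) - N) = ∑ n ∈ Icc (-N : ℤ) N, f n := by
  refine sum_nbij (fun j : ℕ => (j : ℤ) - N) ?_ ?_ ?_ ?_
  · intro j hj
    simp only [mem_range, mem_Icc] at hj ⊢
    omega
  · intro a _ b _ h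
    simpa using h
  · intro n hn
    simp only [coe_Icc, Set.mem_Icc] at hn
    refine ⟨(n + N).toNat, ?_, ?_⟩
    · simp only [coe_range, Set.mem_Iio]; omega
    · dsimp only; omega
  · simp

/-- A bilateral form of Tannery's theorem. -/
lemma tendsto_sum_mul_mul {b : ℤ → ℂ} (hb : Summable b) {u v : ℕ → ℂ} {U V : ℂ}
    (hu : Tendsto u atTop (𝓝 U)) (hv : Tendsto v atTop (𝓝 V)) :
    Tendsto (fun N : ℕ => ∑ j ∈ range (2 * N + 1), b ((j : ℤ) - N) * (u j * v (2 * N - j)))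
      atTop (𝓝 ((∑' n, b n) * (U * V))) := by
  obtain ⟨A, hA⟩ := (Metric.isBounded_range_of_tendsto u hu).exists_norm_le
  obtain ⟨B, hB⟩ := (Metric.isBounded_range_of_tendsto v hv).exists_norm_le
  -- Extending by zero outside [-N, N] gives a series over ℤ dominated by ‖b n‖AB; `toNat` truncates
  -- nothing inside the window.
  let g : ℕ → ℤ → ℂ := fun N n => if n ∈ Icc (-N : ℤ) N then
    b n * (u (n + N).toNat * v (N - n).toNat) else 0
  have hg : ∀ N : ℕ, ∑ j ∈ range (2 * N + 1), b ((j : ℤ) - N) * (u j * v (2 * N - j)) =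
      ∑' n, g N n := by
    intro N
    rw [tsum_eq_sum (s := Icc (-N : ℤ) N) (fun n hn => if_neg hn), ← sum_range_sub_eq_sum_Icc]
    refine sum_congr rfl fun j hj => ?_
    have hj := mem_range.mp hj
    have h1 : ((j : ℤ) - N + N).toNat = j := by omega
    have h2 : ((N : ℤ) - (j - N)).toNat = 2 * N - j := by omega
    rw [if_pos (mem_Icc.mpr ⟨by omega, by omega⟩), h1, h2]
  simp_rw [hg]
  rw [← tsum_mul_right]
  refine tendsto_tsum_of_dominated_convergence (bound := fun n => ‖b n‖ * (A * B))
    (hb.norm.mul_right _) (fun n => ?_) (.of_forall fun N n => ?_)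
  · have hu' : Tendsto (fun N : ℕ => u (n + N).toNat) atTop (𝓝 U) :=
      hu.comp (tendsto_atTop.mpr fun c => eventually_atTop.mpr ⟨c + n.natAbs, fun N _ => by omega⟩)
    have hv' : Tendsto (fun N : ℕ => v (N - n).toNat) atTop (𝓝 V) :=
      hv.comp (tendsto_atTop.mpr fun c => eventually_atTop.mpr ⟨c + n.natAbs, fun N _ => by omega⟩)
    refine ((hu'.mul hv').const_mul (b n)).congr' (eventually_atTop.mpr ⟨n.natAbs, fun N _ => ?_⟩)
    exact (if_pos (mem_Icc.mpr ⟨by omega, by omega⟩)).symm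
  · have hA' := hA _ ⟨(n + N).toNat, rfl⟩
    have hB' := hB _ ⟨((N : ℤ) - n).toNat, rfl⟩
    have hA0 := (norm_nonneg _).trans hA'
    dsimp only [g]
    split_ifs
    · rw [norm_mul, norm_mul]
      gcongr
    · rw [norm_zero]
      exact mul_nonneg (norm_nonneg _) (mul_nonneg hA0 ((norm_nonneg _).trans hB'))

lemma qFin_add (a Q : ℂ) (m n : ℕ) : qFin a Q (m + n) = qFin a Q m * qFin (a * Q ^ m) Q n := by
  simp only [qFin, prod_range_add]
  congr 1
  exact prod_congr rfl fun i _ => by ring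

/-- Each factor is turned around: 1 - zQ^(-i) = -zQ^(-i)(1 - Q^i/z) for 1 ≤ i ≤ N. -/
lemma qFin_div_pow {z Q : ℂ} (hz : z ≠ 0) (hQ : Q ≠ 0) (N : ℕ) :
    qFin (z / Q ^ N) Q N = (-z) ^ N / Q ^ ((N + 1).choose 2) * qFin (Q / z) Q N := by
  induction N with
  | zero => simp [qFin]
  | succ N ih =>
    have h1 : z / Q ^ (N + 1) * Q ^ 1 = z / Q ^ N := by
      field_simp
      ring
    have hc : (N + 2).choose 2 = N + 1 + (N + 1).choose 2 := by
      rw [Nat.choose_succ_succ' (N + 1) 1, Nat.choose_one_right]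
    rw [add_comm N 1, qFin_add, add_comm 1 N, h1, ih, qFin_succ (Q / z), hc, qFin_succ, qFin_zero]
    rw [pow_zero, mul_one, pow_add Q (N + 1), neg_pow z (N + 1), neg_pow z N]
    field_simp
    ring

lemma qFin_div_pow_two_mul {z Q : ℂ} (hz : z ≠ 0) (hQ : Q ≠ 0) (N : ℕ) :
    qFin (z / Q ^ N) Q (2 * N) =
      (-z) ^ N / Q ^ ((N + 1).choose 2) * (qFin z Q N * qFin (Q / z) Q N) := by
  rw [two_mul, qFin_add, qFin_div_pow hz hQ, div_mul_cancel₀ _ (pow_ne_zero _ hQ)]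
  ring

lemma two_mul_mul_pred_ediv_two (n : ℤ) : 2 * (n * (n - 1) / 2) = n * (n - 1) :=
  Int.two_mul_ediv_two_of_even (Int.even_mul_pred_self n)

lemma natCast_choose_two (n : ℕ) : 2 * ((n.choose 2 : ℕ) : ℤ) = (n : ℤ) * (n - 1) := by
  induction n with
  | zero => simp
  | succ n ih =>
    rw [Nat.choose_succ_succ' n 1, Nat.choose_one_right]
    push_cast
    linarith

/-- The finite Jacobi triple product. -/
lemma qFin_mul_qFin_eq_sum {z Q : ℂ} (hz : z ≠ 0) (hQ : Q ≠ 0) (hQ1 : ‖Q‖ < 1) (N : ℕ) :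
    qFin z Q N * qFin (Q / z) Q N = qFin Q Q (2 * N) * ∑ j ∈ range (2 * N + 1),
      ((-z) ^ ((j : ℤ) - N) * Q ^ (((j : ℤ) - N) * ((j : ℤ) - N - 1) / 2)) *
        ((qFin Q Q j)⁻¹ * (qFin Q Q (2 * N - j))⁻¹) := by
  have hC : (-z) ^ N / Q ^ ((N + 1).choose 2) ≠ 0 :=
    div_ne_zero (pow_ne_zero _ (neg_ne_zero.mpr hz)) (pow_ne_zero _ hQ)
  apply mul_left_cancel₀ hC
  -- The q-binomial theorem at w = z/Q^N with 2N factors, recentred by j ↦ j - N.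
  rw [← qFin_div_pow_two_mul hz hQ, qFin_eq_sum hQ1, mul_sum, mul_sum]
  refine sum_congr rfl fun j _ => ?_
  have key : (-(z / Q ^ N)) ^ j * Q ^ (j.choose 2) = (-z) ^ N / Q ^ ((N + 1).choose 2) *
      ((-z) ^ ((j : ℤ) - N) * Q ^ (((j : ℤ) - N) * ((j : ℤ) - N - 1) / 2)) := by
    have e : -((N : ℤ) * j) + (j.choose 2 : ℕ) =
        -((N + 1).choose 2 : ℕ) + (((j : ℤ) - N) * ((j : ℤ) - N - 1) / 2) := by
      have h1 := natCast_choose_two j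
      have h2 := natCast_choose_two (N + 1)
      have h3 := two_mul_mul_pred_ediv_two ((j : ℤ) - N)
      push_cast at h2
      linarith
    have e2 : (-z) ^ N * (-z) ^ ((j : ℤ) - N) = (-z) ^ j := by
      rw [← zpow_natCast, ← zpow_add₀ (neg_ne_zero.mpr hz), add_sub_cancel, zpow_natCast]
    have e3 := congrArg (Q ^ ·) e
    rw [zpow_add₀ hQ, zpow_add₀ hQ, zpow_neg, zpow_neg, zpow_natCast, zpow_natCast, zpow_mul,
      zpow_natCast, zpow_natCast] at e3
    rw [← neg_div, div_pow, div_eq_mul_inv _ ((Q ^ N) ^ j), mul_assoc, e3, ← e2]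
    ring
  rw [key]
  ring

/-! ### Jacobi's triple product and his cube identity. -/

lemma summable_pow_mul_pow_choose_two {w Q : ℂ} (hw : w ≠ 0) (hQ : Q ≠ 0) (hQ1 : ‖Q‖ < 1) :
    Summable fun n : ℕ => w ^ n * Q ^ (n.choose 2) := by
  refine summable_of_ratio_test_tendsto_lt_one (l := 0) one_pos
    (.of_forall fun n => mul_ne_zero (pow_ne_zero _ hw) (pow_ne_zero _ hQ)) ?_
  have h : ∀ n : ℕ, ‖w ^ (n + 1) * Q ^ ((n + 1).choose 2)‖ / ‖w ^ n * Q ^ (n.choose 2)‖ =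
      ‖w‖ * ‖Q‖ ^ n := by
    intro n
    rw [Nat.choose_succ_succ' n 1, Nat.choose_one_right, ← norm_div, ← norm_pow, ← norm_mul]
    congr 1
    rw [pow_add, pow_succ, one_add_one_eq_two]
    field_simp
    ring
  simp_rw [h]
  simpa using (tendsto_pow_atTop_nhds_zero_of_lt_one (norm_nonneg Q) hQ1).const_mul ‖w‖

/-- The bound n ≤ 2^n absorbs the extra factor by replacing w with 2w. -/
lemma summable_mul_pow_mul_pow_choose_two {w Q : ℂ} (hw : w ≠ 0) (hQ : Q ≠ 0) (hQ1 : ‖Q‖ < 1) :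
    Summable fun n : ℕ => (n : ℂ) * (w ^ n * Q ^ (n.choose 2)) := by
  refine Summable.of_norm_bounded
    (summable_pow_mul_pow_choose_two (mul_ne_zero two_ne_zero hw) hQ hQ1).norm fun n => ?_
  rw [mul_pow, mul_assoc, norm_mul, norm_mul (2 ^ n), norm_pow (2 : ℂ)]
  gcongr
  simpa using mod_cast Nat.lt_two_pow_self.le

lemma theta_term_natCast (z Q : ℂ) (n : ℕ) :
    (-z) ^ (n : ℤ) * Q ^ ((n : ℤ) * (n - 1) / 2) = (-z) ^ n * Q ^ (n.choose 2) := by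
  rw [← natCast_choose_two, Int.mul_ediv_cancel_left _ two_ne_zero, zpow_natCast, zpow_natCast]

lemma theta_term_neg_natCast (z Q : ℂ) (n : ℕ) :
    (-z) ^ (-(n : ℤ)) * Q ^ (-(n : ℤ) * (-(n : ℤ) - 1) / 2) =
      (-(Q / z)) ^ n * Q ^ (n.choose 2) := by
  have h : -(n : ℤ) * (-(n : ℤ) - 1) = 2 * ((n + n.choose 2 : ℕ) : ℤ) := by
    push_cast
    linarith [natCast_choose_two n]
  rw [h, Int.mul_ediv_cancel_left _ two_ne_zero, zpow_neg, zpow_natCast, zpow_natCast, pow_add,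
    ← div_neg, div_pow]
  ring

lemma summable_theta {z Q : ℂ} (hz : z ≠ 0) (hQ : Q ≠ 0) (hQ1 : ‖Q‖ < 1) :
    Summable fun n : ℤ => (-z) ^ n * Q ^ (n * (n - 1) / 2) := by
  refine Summable.of_nat_of_neg ?_ ?_
  · simp_rw [theta_term_natCast]
    exact summable_pow_mul_pow_choose_two (neg_ne_zero.mpr hz) hQ hQ1
  · simp_rw [theta_term_neg_natCast]
    exact summable_pow_mul_pow_choose_two (neg_ne_zero.mpr (div_ne_zero hQ hz)) hQ hQ1

lemma summable_intCast_mul_theta {z Q : ℂ} (hz : z ≠ 0) (hQ : Q ≠ 0) (hQ1 : ‖Q‖ < 1) :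
    Summable fun n : ℤ => (n : ℂ) * ((-z) ^ n * Q ^ (n * (n - 1) / 2)) := by
  refine Summable.of_nat_of_neg ?_ ?_
  · simp_rw [theta_term_natCast, Int.cast_natCast]
    exact summable_mul_pow_mul_pow_choose_two (neg_ne_zero.mpr hz) hQ hQ1
  · simp_rw [theta_term_neg_natCast, Int.cast_neg, Int.cast_natCast, neg_mul]
    exact (summable_mul_pow_mul_pow_choose_two (neg_ne_zero.mpr (div_ne_zero hQ hz)) hQ hQ1).neg

lemma tendsto_two_mul_atTop : Tendsto (fun N : ℕ => 2 * N) atTop atTop :=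
  tendsto_id.const_mul_atTop' two_pos

/-- The Jacobi triple product. -/
theorem hasSum_jacobi_triple {z Q : ℂ} (hz : z ≠ 0) (hQ : Q ≠ 0) (hQ1 : ‖Q‖ < 1) :
    HasSum (fun n : ℤ => (-z) ^ n * Q ^ (n * (n - 1) / 2))
      (qInf Q Q * (qInf z Q * qInf (Q / z) Q)) := by
  have hE : qInf Q Q ≠ 0 := qInf_ne_zero_of_norm_lt_one hQ1 hQ1
  have hs := summable_theta hz hQ hQ1
  have hinv := (tendsto_qFin Q hQ1).inv₀ hE
  have h1 := ((tendsto_qFin Q hQ1).comp tendsto_two_mul_atTop).mul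
    (tendsto_sum_mul_mul hs hinv hinv)
  have h2 := (tendsto_qFin z hQ1).mul (tendsto_qFin (Q / z) hQ1)
  have h3 := tendsto_nhds_unique (h2.congr fun N => qFin_mul_qFin_eq_sum hz hQ hQ1 N) h1
  convert hs.hasSum using 1
  rw [h3]
  field_simp

/-- The finite triple product is differentiated at z = 1. Its factor 1 - z vanishes there, so only
the derivative -1 of that factor contributes. Working with finite sums avoids differentiating a
series; N + 1 ensures that the factor is present. -/
lemma deriv_finite_jacobi_triple {Q : ℂ} (hQ : Q ≠ 0) (hQ1 : ‖Q‖ < 1) (N : ℕ) :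
    -(qFin Q Q N * qFin Q Q (N + 1)) = qFin Q Q (2 * (N + 1)) * ∑ j ∈ range (2 * (N + 1) + 1),
      ((((j : ℤ) - (N + 1 : ℕ) : ℤ) : ℂ) * ((-1) ^ ((j : ℤ) - (N + 1 : ℕ)) *
        Q ^ (((j : ℤ) - (N + 1 : ℕ)) * ((j : ℤ) - (N + 1 : ℕ) - 1) / 2))) *
        ((qFin Q Q j)⁻¹ * (qFin Q Q (2 * (N + 1) - j))⁻¹) := by
  have hd : ∀ n : ℤ, HasDerivAt (fun z : ℂ => (-z) ^ n) (n * (-1) ^ n) 1 := by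
    intro n
    have := (hasDerivAt_zpow n (-1 : ℂ) (.inl (by simp))).comp (1 : ℂ) (hasDerivAt_neg 1)
    rw [zpow_sub_one₀ (by simp)] at this
    simpa [Function.comp_def] using this
  have h1 : HasDerivAt (fun z : ℂ => qFin Q Q (2 * (N + 1)) * ∑ j ∈ range (2 * (N + 1) + 1),
      ((-z) ^ ((j : ℤ) - (N + 1 : ℕ)) *
        Q ^ (((j : ℤ) - (N + 1 : ℕ)) * ((j : ℤ) - (N + 1 : ℕ) - 1) / 2)) *
        ((qFin Q Q j)⁻¹ * (qFin Q Q (2 * (N + 1) - j))⁻¹)) _ 1 :=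
    (HasDerivAt.fun_sum fun j _ => ((hd _).mul_const _).mul_const _).const_mul _
  have hdiff : DifferentiableAt ℂ (fun z : ℂ => qFin (z * Q) Q N * qFin (Q / z) Q (N + 1)) 1 := by
    unfold qFin
    refine DifferentiableAt.mul ?_ ?_
    · fun_prop
    · refine DifferentiableAt.fun_finsetProd fun i _ => ?_
      exact (((differentiableAt_const Q).div differentiableAt_fun_id one_ne_zero).mul_const
        _).const_sub _
  have h2 := ((hasDerivAt_id (1 : ℂ)).const_sub 1).mul hdiff.hasDerivAt
  have h3 := h2.unique (h1.congr_of_eventuallyEq ?_)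
  · simpa [mul_assoc] using h3
  · filter_upwards [isOpen_ne.mem_nhds (one_ne_zero (α := ℂ))] with z hz
    rw [← qFin_mul_qFin_eq_sum hz hQ hQ1, add_comm N 1, qFin_add z Q 1 N, add_comm 1 N]
    simp [qFin_succ, qFin_zero, mul_assoc]

/-- Jacobi's identity for the cube of Euler's product. -/
theorem hasSum_jacobi_cube {Q : ℂ} (hQ : Q ≠ 0) (hQ1 : ‖Q‖ < 1) :
    HasSum (fun n : ℤ => (n : ℂ) * ((-1) ^ n * Q ^ (n * (n - 1) / 2))) (-(qInf Q Q) ^ 3) := by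
  have hE : qInf Q Q ≠ 0 := qInf_ne_zero_of_norm_lt_one hQ1 hQ1
  obtain ⟨S, hS⟩ := summable_intCast_mul_theta one_ne_zero hQ hQ1
  have hinv := (tendsto_qFin Q hQ1).inv₀ hE
  have ht := tendsto_qFin Q hQ1
  have h1 := ((ht.comp tendsto_two_mul_atTop).mul
    (tendsto_sum_mul_mul hS.summable hinv hinv)).comp (tendsto_add_atTop_nat 1)
  have h2 := (ht.mul (ht.comp (tendsto_add_atTop_nat 1))).neg
  have h3 := tendsto_nhds_unique (h2.congr fun N => deriv_finite_jacobi_triple hQ hQ1 N) h1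
  rw [hS.tsum_eq] at h3
  convert hS using 1
  field_simp at h3
  exact h3

/-! ### Partial fractions and Kronecker's bilateral sum. -/

lemma prod_range_erase (g : ℕ → ℂ) (k m : ℕ) :
    ∏ j ∈ (range (k + m + 1)).erase k, g j =
      (∏ j ∈ range k, g j) * ∏ i ∈ range m, g (k + 1 + i) := by
  have h : (range (k + m + 1)).erase k = range k ∪ (range m).map (addLeftEmbedding (k + 1)) := by
    ext j
    simp only [mem_erase, mem_range, mem_union, Finset.mem_map, addLeftEmbedding_apply]
    constructor
    · intro h
      by_cases hj : j < k
      · exact .inl hj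
      · exact .inr ⟨j - (k + 1), by omega, by omega⟩
    · rintro (h | ⟨i, hi, rfl⟩) <;> omega
  rw [h, prod_union, prod_map]
  · rfl
  · rw [disjoint_left]
    simp only [mem_range, Finset.mem_map, addLeftEmbedding_apply]
    rintro j hj ⟨i, _, rfl⟩
    omega

/-- Used at x = 1 for the nodal weights and at general x for the values of the interpolated
polynomial. -/
lemma prod_range_pow_sub {x Q : ℂ} (hx : x ≠ 0) (k : ℕ) :
    ∏ j ∈ range k, (Q ^ k - x * Q ^ j) = (-x) ^ k * Q ^ (k.choose 2) * qFin (Q / x) Q k := by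
  induction k with
  | zero => simp [qFin]
  | succ k ih =>
    have h : ∀ j ∈ range k, Q ^ (k + 1) - x * Q ^ (j + 1) = Q * (Q ^ k - x * Q ^ j) :=
      fun j _ => by ring
    rw [prod_range_succ', prod_congr rfl h, prod_mul_distrib, ih, prod_const, card_range,
      qFin_succ, Nat.choose_succ_succ' k 1, Nat.choose_one_right, pow_add, one_add_one_eq_two]
    field_simp
    ring

lemma prod_range_pow_sub_pow_add (x Q : ℂ) (k m : ℕ) :
    ∏ i ∈ range m, (Q ^ k - x * Q ^ (k + i)) = (Q ^ k) ^ m * qFin x Q m := by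
  rw [qFin, ← card_range m, ← prod_const, card_range, ← prod_mul_distrib]
  exact prod_congr rfl fun i _ => by ring

lemma pow_injective_of_norm_lt_one {Q : ℂ} (hQ : Q ≠ 0) (hQ1 : ‖Q‖ < 1) :
    Function.Injective fun n : ℕ => Q ^ n := fun a b h =>
  pow_right_injective₀ (norm_pos_iff.mpr hQ) hQ1.ne (by simpa using congrArg (‖·‖) h)

/-- The partial fraction expansion of a quotient of finite `q`-Pochhammer symbols. -/
lemma qFin_div_qFin_eq_sum {t x Q : ℂ} (ht : t ≠ 0) (hx : x ≠ 0) (hQ : Q ≠ 0) (hQ1 : ‖Q‖ < 1)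
    (M : ℕ) (h : ∀ k : ℕ, 1 - t * Q ^ k ≠ 0) :
    qFin (t * x) Q M / qFin t Q (M + 1) = ∑ k ∈ range (M + 1),
      x ^ k / (1 - t * Q ^ k) * (qFin (Q / x) Q k / qFin Q Q k *
        (qFin x Q (M - k) / qFin Q Q (M - k))) := by
  classical
  have hne := qFin_ne_zero_of_norm_lt_one hQ1 hQ1
  let v : ℕ → ℂ := fun n => Q ^ n
  -- Of degree M, so interpolation at the M + 1 nodes Q^k is exact; evaluating at t⁻¹ gives the
  -- partial fractions.
  let f : Polynomial ℂ := ∏ j ∈ range M, (Polynomial.X - Polynomial.C (x * Q ^ j))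
  have hev : ∀ y, f.eval y = ∏ j ∈ range M, (y - x * Q ^ j) := fun y => by
    simp [f, Polynomial.eval_prod]
  have hdeg : f.degree < #(range (M + 1)) := by
    rw [Polynomial.degree_prod]
    simp only [Polynomial.degree_X_sub_C, sum_const, card_range, nsmul_eq_mul, mul_one]
    exact_mod_cast Nat.lt_succ_self M
  have hfact : ∀ k, t⁻¹ - v k = t⁻¹ * (1 - t * Q ^ k) := fun k => by simp only [v]; field_simp
  have hnode : ∀ k ∈ range (M + 1), t⁻¹ ≠ v k := fun k _ => by
    rw [← sub_ne_zero, hfact]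
    exact mul_ne_zero (inv_ne_zero ht) (h k)
  have hI := congrArg (Polynomial.eval t⁻¹)
    (Lagrange.eq_interpolate (s := range (M + 1)) (v := v)
      (pow_injective_of_norm_lt_one hQ hQ1).injOn hdeg)
  rw [Lagrange.eval_interpolate_not_at_node _ hnode, hev, Lagrange.eval_nodal] at hI
  have e1 : ∏ j ∈ range M, (t⁻¹ - x * Q ^ j) = t⁻¹ ^ M * qFin (t * x) Q M := by
    rw [qFin, ← card_range M, ← prod_const, card_range, ← prod_mul_distrib]
    exact prod_congr rfl fun i _ => by field_simp
  have e2 : ∏ j ∈ range (M + 1), (t⁻¹ - v j) = t⁻¹ ^ (M + 1) * qFin t Q (M + 1) := by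
    rw [qFin, ← card_range (M + 1), ← prod_const, card_range, ← prod_mul_distrib]
    exact prod_congr rfl fun i _ => hfact i
  have hq : qFin t Q (M + 1) ≠ 0 := prod_ne_zero_iff.mpr fun i _ => h i
  rw [e1, e2] at hI
  have hI' : qFin (t * x) Q M / qFin t Q (M + 1) = t⁻¹ * ∑ k ∈ range (M + 1),
      Lagrange.nodalWeight (range (M + 1)) v k * (t⁻¹ - v k)⁻¹ * Polynomial.eval (v k) f := by
    rw [div_eq_iff hq]
    apply mul_left_cancel₀ (pow_ne_zero M (inv_ne_zero ht))
    rw [hI]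
    ring
  rw [hI', mul_sum]
  refine sum_congr rfl fun k hk => ?_
  obtain ⟨m, rfl⟩ : ∃ m, M = k + m := ⟨M - k, by have := mem_range.mp hk; omega⟩
  have hw : Lagrange.nodalWeight (range (k + m + 1)) v k =
      ((-1) ^ k * Q ^ (k.choose 2) * qFin Q Q k * ((Q ^ k) ^ m * qFin Q Q m))⁻¹ := by
    rw [Lagrange.nodalWeight, prod_inv_distrib, prod_range_erase]
    have a1 := prod_range_pow_sub (x := 1) (Q := Q) one_ne_zero k
    have a2 := prod_range_pow_sub_pow_add Q Q k m
    simp only [one_mul, div_one] at a1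
    rw [← a1, ← a2]
    congr 2
    exact prod_congr rfl fun i _ => by simp only [v]; ring
  rw [hw, hev, hfact, prod_range_add, prod_range_pow_sub hx, prod_range_pow_sub_pow_add,
    Nat.add_sub_cancel_left, neg_pow x]
  have := hne k
  have := hne m
  have := h k
  field_simp

/-- Replacing a by a/Q^N centres the 2N + 1 partial fractions at index 0, ready for a bilateral
limit. -/
lemma qFin_div_pow_quotient {a x Q : ℂ} (ha : a ≠ 0) (hx : x ≠ 0) (hQ : Q ≠ 0) (N : ℕ) :
    qFin (a / Q ^ N * x) Q (2 * N) / qFin (a / Q ^ N) Q (2 * N + 1) =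
      x ^ N * (qFin (a * x) Q N * qFin (Q / (a * x)) Q N /
        (qFin a Q (N + 1) * qFin (Q / a) Q N)) := by
  have h1 : a / Q ^ N * x = a * x / Q ^ N := by ring
  have h2 : 2 * N + 1 = N + (N + 1) := by ring
  rw [h1, qFin_div_pow_two_mul (mul_ne_zero ha hx) hQ, h2, qFin_add _ _ N (N + 1),
    qFin_div_pow ha hQ, div_mul_cancel₀ _ (pow_ne_zero _ hQ), ← neg_mul, mul_pow]
  have h3 : (-a) ^ N ≠ 0 := pow_ne_zero _ (neg_ne_zero.mpr ha)
  generalize (-a) ^ N = c at *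
  field_simp

/-- The terms are comparable to x^n as k = n → ∞, and to (Q/x)^n at k = -n; hence the annulus ‖Q‖ <
‖x‖ < 1. -/
lemma summable_bilateral_geometric {a x Q : ℂ} (ha : a ≠ 0) (hQ : Q ≠ 0) (hxQ : ‖Q‖ < ‖x‖)
    (hx1 : ‖x‖ < 1) : Summable fun k : ℤ => x ^ k / (1 - a * Q ^ k) := by
  have hQ1 : ‖Q‖ < 1 := hxQ.trans hx1
  have hx : x ≠ 0 := norm_pos_iff.mp ((norm_nonneg _).trans_lt hxQ)
  have hQ0 : Tendsto (fun n : ℕ => Q ^ n) atTop (𝓝 0) :=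
    tendsto_pow_atTop_nhds_zero_of_norm_lt_one hQ1
  have aux : ∀ (y : ℂ) (c : ℕ → ℂ) (L : ℂ), ‖y‖ < 1 → Tendsto c atTop (𝓝 L) →
      Summable fun n : ℕ => y ^ n * c n := by
    intro y c L hy hc
    refine summable_of_isBigO_nat (summable_geometric_of_lt_one (norm_nonneg y) hy) ?_
    have := (Asymptotics.isBigO_refl (fun n : ℕ => y ^ n) atTop).mul
      (hc.isBigO_one ℂ)
    simpa using this.norm_right
  refine Summable.of_nat_of_neg ?_ ?_
  · simp_rw [zpow_natCast, div_eq_mul_inv]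
    refine aux x _ _ hx1 (((hQ0.const_mul a).const_sub 1).inv₀ (by simp))
  · have h : ∀ n : ℕ, x ^ (-(n : ℤ)) / (1 - a * Q ^ (-(n : ℤ))) =
        (Q / x) ^ n * (Q ^ n - a)⁻¹ := by
      intro n
      rw [zpow_neg, zpow_neg, zpow_natCast, zpow_natCast, div_pow]
      have : 1 - a * (Q ^ n)⁻¹ = (Q ^ n - a) / Q ^ n := by field_simp
      rw [this]
      field_simp
    simp_rw [h]
    refine aux _ _ _ ?_ ((hQ0.sub_const a).inv₀ (by simpa using ha))
    rw [norm_div]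
    exact (div_lt_one ((norm_nonneg _).trans_lt hxQ)).mpr hxQ

/-- Kronecker's bilateral sum, a special case of Ramanujan's `₁ψ₁` summation. -/
theorem hasSum_kronecker {a x Q : ℂ} (ha : a ≠ 0) (hQ : Q ≠ 0) (hxQ : ‖Q‖ < ‖x‖)
    (hx1 : ‖x‖ < 1) (h : ∀ k : ℤ, 1 - a * Q ^ k ≠ 0) :
    HasSum (fun k : ℤ => x ^ k / (1 - a * Q ^ k))
      (qInf Q Q ^ 2 * (qInf (a * x) Q * qInf (Q / (a * x)) Q) /
        (qInf x Q * qInf (Q / x) Q * (qInf a Q * qInf (Q / a) Q))) := by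
  have hQ1 : ‖Q‖ < 1 := hxQ.trans hx1
  have hx : x ≠ 0 := norm_pos_iff.mp ((norm_nonneg _).trans_lt hxQ)
  have hQx1 : ‖Q / x‖ < 1 := by
    rw [norm_div]
    exact (div_lt_one ((norm_nonneg _).trans_lt hxQ)).mpr hxQ
  have hE : qInf Q Q ≠ 0 := qInf_ne_zero_of_norm_lt_one hQ1 hQ1
  have hX : qInf x Q ≠ 0 := qInf_ne_zero_of_norm_lt_one hx1 hQ1
  have hQX : qInf (Q / x) Q ≠ 0 := qInf_ne_zero_of_norm_lt_one hQx1 hQ1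
  have hA : qInf a Q ≠ 0 := qInf_ne_zero hQ1 fun i => by simpa using h i
  -- A zero of the i-th factor would be a pole of the sum at k = -(i+1).
  have hQA : qInf (Q / a) Q ≠ 0 := qInf_ne_zero hQ1 fun i h0 => h (-(i + 1 : ℕ)) <| by
    rw [zpow_neg, zpow_natCast, pow_succ]
    field_simp at h0 ⊢
    linear_combination -h0
  obtain ⟨S, hS⟩ := summable_bilateral_geometric ha hQ hxQ hx1
  have ht := tendsto_qFin Q hQ1
  have h1 := tendsto_sum_mul_mul hS.summable ((tendsto_qFin (Q / x) hQ1).div ht hE)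
    ((tendsto_qFin x hQ1).div ht hE)
  have h2 := ((tendsto_qFin (a * x) hQ1).mul (tendsto_qFin (Q / (a * x)) hQ1)).div
    (((tendsto_qFin a hQ1).comp (tendsto_add_atTop_nat 1)).mul (tendsto_qFin (Q / a) hQ1))
    (mul_ne_zero hA hQA)
  have h3 := tendsto_nhds_unique (h2.congr fun N => ?_) h1
  · rw [hS.tsum_eq] at h3
    convert hS using 1
    field_simp at h3 ⊢
    linear_combination h3
  · have hs : ∀ k : ℕ, a / Q ^ N * Q ^ k = a * Q ^ ((k : ℤ) - N) := fun k => by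
      rw [zpow_sub₀ hQ, zpow_natCast, zpow_natCast]
      ring
    apply mul_left_cancel₀ (pow_ne_zero N hx)
    have e := qFin_div_pow_quotient ha hx hQ N
    rw [qFin_div_qFin_eq_sum (div_ne_zero ha (pow_ne_zero _ hQ)) hx hQ hQ1 _
      (fun k => by rw [hs]; exact h _)] at e
    simp only [Pi.div_apply, Function.comp_apply]
    rw [← e, mul_sum]
    refine sum_congr rfl fun k _ => ?_
    rw [hs, zpow_sub₀ hx, zpow_natCast, zpow_natCast]
    field_simp

/-! ### Dissections of infinite products. -/

lemma prod_range_mul_range (f : ℕ → ℂ) (k N : ℕ) :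
    ∏ n ∈ range (k * N), f n = ∏ i ∈ range k, ∏ m ∈ range N, f (k * m + i) := by
  induction N with
  | zero => simp
  | succ N ih =>
    rw [mul_add, mul_one, prod_range_add, ih]
    simp_rw [prod_range_succ, prod_mul_distrib]

/-- The factors are sorted by the residue of their index modulo k, on the first kN of them. -/
lemma qInf_eq_prod (a : ℂ) {Q : ℂ} (hQ1 : ‖Q‖ < 1) {k : ℕ} (hk : 0 < k) :
    qInf a Q = ∏ i ∈ range k, qInf (a * Q ^ i) (Q ^ k) := by
  have hQk : ‖Q ^ k‖ < 1 := by
    rw [norm_pow]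
    exact pow_lt_one₀ (norm_nonneg _) hQ1 hk.ne'
  have h1 := (tendsto_qFin a hQ1).comp (tendsto_id.const_mul_atTop' hk)
  have h2 := tendsto_finsetProd (range k) fun i _ => tendsto_qFin (a * Q ^ i) hQk
  refine tendsto_nhds_unique (h1.congr fun N => ?_) h2
  rw [Function.comp_apply, id, qFin, prod_range_mul_range]
  exact prod_congr rfl fun i _ => prod_congr rfl fun m _ => by ring

lemma qInf_mul_qInf_neg (a : ℂ) {Q : ℂ} (hQ1 : ‖Q‖ < 1) :
    qInf a Q * qInf (-a) Q = qInf (a ^ 2) (Q ^ 2) := by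
  rw [qInf, qInf, ← (multipliable_one_sub_mul_pow a hQ1).tprod_mul
    (multipliable_one_sub_mul_pow (-a) hQ1)]
  exact tprod_congr fun i => by ring

/-- Euler's product `∏_{n ≥ 1} (1 - q ^ n)`. -/
noncomputable def eulerProd (q : ℂ) : ℂ := qInf q q

lemma eulerProd_ne_zero {q : ℂ} (hq : ‖q‖ < 1) : eulerProd q ≠ 0 :=
  qInf_ne_zero_of_norm_lt_one hq hq

lemma norm_pow_lt_one {q : ℂ} (hq : ‖q‖ < 1) {k : ℕ} (hk : k ≠ 0) : ‖q ^ k‖ < 1 := by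
  rw [norm_pow]
  exact pow_lt_one₀ (norm_nonneg _) hq hk

lemma qInf_sq_mul_eulerProd {q : ℂ} (hq : ‖q‖ < 1) :
    qInf q (q ^ 2) * eulerProd (q ^ 2) = eulerProd q := by
  rw [eulerProd, eulerProd, qInf_eq_prod q hq (k := 2) (by norm_num), prod_range_succ, prod_range_one]
  ring_nf

/-- From (q;q²)(-q;q²) = (q²;q⁴), with (q;q²) = E(q)/E(q²) and the same at q². -/
lemma qInf_neg_sq_mul {q : ℂ} (hq : ‖q‖ < 1) :
    qInf (-q) (q ^ 2) * eulerProd q * eulerProd (q ^ 4) = eulerProd (q ^ 2) ^ 2 := by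
  have h2 := norm_pow_lt_one hq two_ne_zero
  have h := qInf_mul_qInf_neg q h2
  have h4 := qInf_sq_mul_eulerProd h2
  rw [← h, show (q ^ 2) ^ 2 = q ^ 4 by ring] at h4
  rw [← qInf_sq_mul_eulerProd hq]
  linear_combination (eulerProd (q ^ 2)) * h4

lemma qInf_two_mul_qInf_four {q : ℂ} (hq : ‖q‖ < 1) :
    qInf (q ^ 2) (q ^ 6) * qInf (q ^ 4) (q ^ 6) * eulerProd (q ^ 6) = eulerProd (q ^ 2) := by
  rw [eulerProd, eulerProd, qInf_eq_prod _ (norm_pow_lt_one hq two_ne_zero) (k := 3) (by norm_num)]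
  simp only [prod_range_succ, prod_range_zero, one_mul]
  ring_nf

lemma qInf_neg_one_three_five {q : ℂ} (hq : ‖q‖ < 1) :
    qInf (-q) (q ^ 6) * qInf (-q ^ 3) (q ^ 6) * qInf (-q ^ 5) (q ^ 6) = qInf (-q) (q ^ 2) := by
  rw [qInf_eq_prod (-q) (norm_pow_lt_one hq two_ne_zero) (k := 3) (by norm_num)]
  simp only [prod_range_succ, prod_range_zero, one_mul]
  ring_nf

/-! ### The Lambert series of the second identity. -/

lemma one_add_ne_zero_of_norm_lt_one {z : ℂ} (h : ‖z‖ < 1) : 1 + z ≠ 0 := by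
  have := one_sub_ne_zero_of_norm_lt_one (z := -z) (by rwa [norm_neg])
  rwa [sub_neg_eq_add] at this

lemma one_add_zpow_ne_zero {q : ℂ} (hq0 : q ≠ 0) (hq : ‖q‖ < 1) {k : ℤ} (hk : k ≠ 0) :
    1 + q ^ k ≠ 0 := by
  have key : ∀ n : ℕ, n ≠ 0 → 1 + q ^ n ≠ 0 := fun n hn =>
    one_add_ne_zero_of_norm_lt_one (norm_pow_lt_one hq hn)
  rcases Int.natAbs_eq k with h | h
  · rw [h, zpow_natCast]
    exact key _ (by simpa)
  · rw [h, zpow_neg, zpow_natCast]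
    intro h0
    apply key k.natAbs (by simpa)
    have := pow_ne_zero k.natAbs hq0
    field_simp at h0
    linear_combination h0

lemma hasSum_odd_int {q : ℂ} (hq0 : q ≠ 0) (hq : ‖q‖ < 1) :
    HasSum (fun k : ℤ => (q ^ 2) ^ k / (1 - -q ^ 3 * (q ^ 6) ^ k))
      (eulerProd (q ^ 2) * eulerProd (q ^ 3) ^ 3 * eulerProd (q ^ 12) ^ 3 /
        (eulerProd q * eulerProd (q ^ 4) * eulerProd (q ^ 6) ^ 3)) := by
  have hn : ‖q‖ ≠ 0 := norm_ne_zero_iff.mpr hq0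
  have h := hasSum_kronecker (a := -q ^ 3) (x := q ^ 2) (Q := q ^ 6) (by simpa) (by simpa)
    (by
      rw [norm_pow, norm_pow]
      exact pow_lt_pow_right_of_lt_one₀ (by positivity) hq (by norm_num))
    -- The denominators are 1 + q^(3+6k), whose odd exponent is never 0.
    (norm_pow_lt_one hq two_ne_zero) (fun k => by
      have := one_add_zpow_ne_zero hq0 hq (k := 3 + 6 * k) (by omega)
      rw [zpow_add₀ hq0, zpow_mul] at this
      simpa using this)
  convert h using 1
  have e1 : -q ^ 3 * q ^ 2 = -q ^ 5 := by ring
  have e2 : q ^ 6 / -q ^ 5 = -q := by field_simp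
  have e3 : q ^ 6 / q ^ 2 = q ^ 4 := by field_simp
  have e4 : q ^ 6 / -q ^ 3 = -q ^ 3 := by field_simp
  have n1 := eulerProd_ne_zero hq
  have n2 := eulerProd_ne_zero (norm_pow_lt_one hq two_ne_zero)
  have n3 := eulerProd_ne_zero (norm_pow_lt_one hq three_ne_zero)
  have n4 := eulerProd_ne_zero (norm_pow_lt_one hq four_ne_zero)
  have n6 := eulerProd_ne_zero (norm_pow_lt_one hq (k := 6) (by norm_num))
  have n12 := eulerProd_ne_zero (norm_pow_lt_one hq (k := 12) (by norm_num))
  have f1 := qInf_two_mul_qInf_four hq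
  have f2 := qInf_neg_sq_mul hq
  have f3 := qInf_neg_sq_mul (norm_pow_lt_one hq three_ne_zero)
  rw [← qInf_neg_one_three_five hq] at f2
  rw [← pow_mul, ← pow_mul] at f3
  norm_num at f3
  rw [e1, e2, e3, e4, show qInf (q ^ 6) (q ^ 6) = eulerProd (q ^ 6) from rfl]
  generalize eulerProd q = E1 at *
  generalize eulerProd (q ^ 2) = E2 at *
  generalize eulerProd (q ^ 3) = E3 at *
  generalize eulerProd (q ^ 4) = E4 at *
  generalize eulerProd (q ^ 6) = E6 at *
  generalize eulerProd (q ^ 12) = E12 at *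
  generalize qInf (-q) (q ^ 6) = A at *
  generalize qInf (-q ^ 3) (q ^ 6) = B at *
  generalize qInf (-q ^ 5) (q ^ 6) = C at *
  generalize qInf (q ^ 2) (q ^ 6) = D at *
  generalize qInf (q ^ 4) (q ^ 6) = F at *
  have hB : B ≠ 0 := by rintro rfl; exact pow_ne_zero 2 n6 (by rw [← f3]; ring)
  have hD : D ≠ 0 := by rintro rfl; simp [n2.symm] at f1
  have hF : F ≠ 0 := by rintro rfl; simp [n2.symm] at f1
  have hCA : C * A = E2 ^ 2 / (E1 * E4 * B) := by
    field_simp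
    linear_combination f2
  have hBe : B = E6 ^ 2 / (E3 * E12) := by
    field_simp
    linear_combination f3
  have hDF : D * F = E2 / E6 := by
    field_simp
    linear_combination f1
  rw [hCA, hDF, hBe]
  field_simp

/-- With y = q^(2n+1), the terms k = n and k = -(n+1) of the bilateral sum, times q, are y/(1+y³)
and y²/(1+y³). -/
lemma hasSum_odd_nat {q : ℂ} (hq0 : q ≠ 0) (hq : ‖q‖ < 1) :
    HasSum (fun n : ℕ => (q ^ (2 * n + 1) + (q ^ (2 * n + 1)) ^ 2) / (1 + (q ^ (2 * n + 1)) ^ 3))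
      (q * (eulerProd (q ^ 2) * eulerProd (q ^ 3) ^ 3 * eulerProd (q ^ 12) ^ 3 /
        (eulerProd q * eulerProd (q ^ 4) * eulerProd (q ^ 6) ^ 3))) := by
  refine HasSum.congr_fun (((hasSum_odd_int hq0 hq).nat_add_neg_add_one).mul_left q)
    fun n => ?_
  have h1 : 1 + (q ^ (2 * n + 1)) ^ 3 ≠ 0 := by
    rw [← pow_mul]
    exact one_add_ne_zero_of_norm_lt_one (norm_pow_lt_one hq (by omega))
  have a1 : (q ^ 2) ^ (n : ℤ) / (1 - -q ^ 3 * (q ^ 6) ^ (n : ℤ)) =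
      q ^ (2 * n) / (1 + (q ^ (2 * n + 1)) ^ 3) := by
    rw [zpow_natCast, zpow_natCast]
    congr 1 <;> ring
  have a2 : (q ^ 2) ^ (-((n : ℤ) + 1)) / (1 - -q ^ 3 * (q ^ 6) ^ (-((n : ℤ) + 1))) =
      q ^ (4 * n + 1) / (1 + (q ^ (2 * n + 1)) ^ 3) := by
    rw [zpow_neg, zpow_neg, ← Nat.cast_succ, zpow_natCast, zpow_natCast]
    have : 1 - -q ^ 3 * ((q ^ 6) ^ (n + 1))⁻¹ =
        (1 + (q ^ (2 * n + 1)) ^ 3) / (q ^ (2 * n + 1)) ^ 3 := by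
      field_simp
      ring
    rw [Nat.succ_eq_add_one, this]
    field_simp
    ring
  rw [a1, a2]
  field_simp
  ring

lemma hasSum_modEq_six {x : ℂ} (hx : ‖x‖ < 1) {j : ℕ} (hj0 : 0 < j) (hj : j < 6) :
    HasSum (fun d : ℕ+ => (if (d : ℕ) ≡ j [MOD 6] then 1 else 0) * x ^ (d : ℕ))
      (x ^ j / (1 - x ^ 6)) := by
  let g : ℕ → ℕ+ := fun n => ⟨6 * n + j, by omega⟩
  have hg : ∀ n, (g n : ℕ) = 6 * n + j := fun _ => rfl
  have hinj : Function.Injective g := fun a b h => by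
    have : 6 * a + j = 6 * b + j := congrArg PNat.val h
    omega
  rw [← hinj.hasSum_iff]
  · refine HasSum.congr_fun ((hasSum_geometric_of_norm_lt_one
      (norm_pow_lt_one hx (k := 6) (by norm_num))).mul_left (x ^ j)) fun n => ?_
    have : 6 * n + j ≡ j [MOD 6] := by simp [Nat.ModEq]
    rw [Function.comp_apply, hg, if_pos this]
    ring
  · intro d hd
    rw [if_neg, zero_mul]
    intro h
    refine hd ⟨d / 6, PNat.eq ?_⟩
    have h' : (d : ℕ) % 6 = j % 6 := h
    rw [hg]
    omega

/-- The odd character-like function modulo `6` with values `1, 1, 0, -1, -1, 0`. -/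
noncomputable def signSix (d : ℕ) : ℂ :=
  (if d ≡ 1 [MOD 6] then 1 else 0) + (if d ≡ 2 [MOD 6] then 1 else 0) -
    (if d ≡ 4 [MOD 6] then 1 else 0) - (if d ≡ 5 [MOD 6] then 1 else 0)

lemma hasSum_signSix_mul_pow {x : ℂ} (hx : ‖x‖ < 1) :
    HasSum (fun d : ℕ+ => signSix d * x ^ (d : ℕ)) ((x + x ^ 2) / (1 + x ^ 3)) := by
  have hval : (x + x ^ 2) / (1 + x ^ 3) =
      x ^ 1 / (1 - x ^ 6) + x ^ 2 / (1 - x ^ 6) - x ^ 4 / (1 - x ^ 6) - x ^ 5 / (1 - x ^ 6) := by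
    have h3 := one_add_ne_zero_of_norm_lt_one (norm_pow_lt_one hx three_ne_zero)
    have h3' := one_sub_ne_zero_of_norm_lt_one (norm_pow_lt_one hx three_ne_zero)
    have h6 : 1 - x ^ 6 = (1 + x ^ 3) * (1 - x ^ 3) := by ring
    rw [h6]
    field_simp
    ring
  rw [hval]
  refine HasSum.congr_fun
    ((((hasSum_modEq_six hx (j := 1) (by norm_num) (by norm_num)).add
    (hasSum_modEq_six hx (j := 2) (by norm_num) (by norm_num))).sub
    (hasSum_modEq_six hx (j := 4) (by norm_num) (by norm_num))).sub
    (hasSum_modEq_six hx (j := 5) (by norm_num) (by norm_num))) fun d => ?_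
  rw [signSix]
  ring

lemma norm_signSix_le_one (d : ℕ) : ‖signSix d‖ ≤ 1 := by
  have h : d % 6 = 0 ∨ d % 6 = 1 ∨ d % 6 = 2 ∨ d % 6 = 3 ∨ d % 6 = 4 ∨ d % 6 = 5 := by omega
  rcases h with h | h | h | h | h | h <;> simp [signSix, Nat.ModEq, h]

lemma sum_divisors_eq_dStar (n : ℕ) :
    ∑ x ∈ n.divisorsAntidiagonal, (if Odd x.1 then 1 else 0) * signSix x.2 =
      (dStar 1 6 n : ℂ) + (dStar 2 6 n : ℂ) - (dStar 4 6 n : ℂ) - (dStar 5 6 n : ℂ) := by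
  rw [Nat.sum_divisorsAntidiagonal' (f := fun a b => (if Odd a then 1 else 0) * signSix b)]
  simp only [dStar, natCast_card_filter, ← sum_add_distrib, ← sum_sub_distrib, signSix]
  refine sum_congr rfl fun d _ => ?_
  by_cases h : Odd (n / d) <;> simp [h]

/-- One absolutely convergent double series over pairs (m, d), m odd, is summed in two ways: over d
for fixed m, giving the Lambert series, and over pairs with md = n, giving the divisor counts. -/
lemma hasSum_dStar {q : ℂ} (hq0 : q ≠ 0) (hq : ‖q‖ < 1) :
    HasSum (fun n : ℕ+ =>
        ((dStar 1 6 n : ℂ) + (dStar 2 6 n : ℂ) - (dStar 4 6 n : ℂ) - (dStar 5 6 n : ℂ)) *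
          q ^ (n : ℕ))
      (q * (eulerProd (q ^ 2) * eulerProd (q ^ 3) ^ 3 * eulerProd (q ^ 12) ^ 3 /
        (eulerProd q * eulerProd (q ^ 4) * eulerProd (q ^ 6) ^ 3))) := by
  let F : ℕ+ × ℕ+ → ℂ := fun c =>
    (if Odd (c.1 : ℕ) then 1 else 0) * signSix c.2 * q ^ (c.1 * c.2 : ℕ)
  have hF : Summable F := by
    refine Summable.of_norm_bounded (summable_prod_mul_pow 0 hq).norm fun c => ?_
    rw [pow_zero, one_mul, norm_mul]
    refine mul_le_of_le_one_left (norm_nonneg _) ?_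
    rw [norm_mul]
    refine mul_le_one₀ ?_ (norm_nonneg _) (norm_signSix_le_one _)
    split_ifs <;> simp
  have hfib := hF.hasSum.prod_fiberwise (g := fun m : ℕ+ => (if Odd (m : ℕ) then 1 else 0) *
      ((q ^ (m : ℕ) + (q ^ (m : ℕ)) ^ 2) / (1 + (q ^ (m : ℕ)) ^ 3))) fun m => by
    refine HasSum.congr_fun
      ((hasSum_signSix_mul_pow (norm_pow_lt_one hq m.ne_zero)).mul_left
        (if Odd (m : ℕ) then (1 : ℂ) else 0)) fun d => ?_
    simp only [F, pow_mul]
    ring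
  let g : ℕ → ℕ+ := fun n => ⟨2 * n + 1, by omega⟩
  have hg : ∀ n, (g n : ℕ) = 2 * n + 1 := fun _ => rfl
  have hinj : Function.Injective g := fun a b h => by
    have : 2 * a + 1 = 2 * b + 1 := congrArg PNat.val h
    omega
  rw [← hinj.hasSum_iff] at hfib
  · have hval := HasSum.unique hfib (a₂ := q * (eulerProd (q ^ 2) * eulerProd (q ^ 3) ^ 3 *
        eulerProd (q ^ 12) ^ 3 / (eulerProd q * eulerProd (q ^ 4) * eulerProd (q ^ 6) ^ 3))) <| by
      refine HasSum.congr_fun (hasSum_odd_nat hq0 hq) fun n => ?_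
      rw [Function.comp_apply, hg, if_pos ⟨n, rfl⟩, one_mul]
    rw [← hval]
    refine ((sigmaAntidiagonalEquivProd.hasSum_iff).mpr hF.hasSum).sigma fun n => ?_
    convert hasSum_fintype _ using 1
    rw [← sum_divisors_eq_dStar, sum_mul,
      ← sum_coe_sort _ (fun x : ℕ × ℕ => (if Odd x.1 then 1 else 0) * signSix x.2 * q ^ (n : ℕ))]
    refine sum_congr rfl fun x _ => ?_
    have hx := (Nat.mem_divisorsAntidiagonal.mp x.2).1
    simp only [F, Function.comp_apply, sigmaAntidiagonalEquivProd, Equiv.coe_fn_mk,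
      divisorsAntidiagonalFactors, PNat.mk_coe, hx]
    congr!
  · intro m hm
    rw [if_neg, zero_mul]
    rintro ⟨k, hk⟩
    exact hm ⟨k, PNat.eq hk.symm⟩

/-! ### Eta values, characters and theta series. -/

lemma eta_natCast_mul (τ : ℂ) (k : ℕ) :
    ModularForm.eta (k * τ) = Complex.exp (2 * Real.pi * Complex.I * τ / 24) ^ k *
      eulerProd (Complex.exp (2 * Real.pi * Complex.I * τ) ^ k) := by
  rw [ModularForm.eta, Function.Periodic.qParam, ← Complex.exp_nat_mul, ← Complex.exp_nat_mul,
    eulerProd, qInf]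
  congr 1
  · congr 1
    push_cast
    ring
  · refine tprod_congr fun n => ?_
    rw [ModularForm.eta_q_eq_pow, pow_succ']
    ring_nf

/-- The odd character modulo `4`. -/
noncomputable def signFour (s : ℤ) : ℂ := if s % 4 = 1 then 1 else if s % 4 = 3 then -1 else 0

/-- This is what lets the sign separate under v = s + 2t. -/
lemma signFour_add_two_mul (s t : ℤ) : signFour (s + 2 * t) = signFour s * (-1) ^ t := by
  have h : s % 4 = 0 ∨ s % 4 = 1 ∨ s % 4 = 2 ∨ s % 4 = 3 := by omega
  obtain ⟨k, rfl | rfl⟩ := Int.even_or_odd' t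
  · rw [Even.neg_one_zpow ⟨k, by ring⟩, mul_one, signFour, signFour,
      show (s + 2 * (2 * k)) % 4 = s % 4 by omega]
  · rw [Odd.neg_one_zpow ⟨k, rfl⟩, signFour, signFour,
      show (s + 2 * (2 * k + 1)) % 4 = (s % 4 + 2) % 4 by omega]
    rcases h with h | h | h | h <;> simp [h]

lemma norm_signFour_le_one (s : ℤ) : ‖signFour s‖ ≤ 1 := by
  unfold signFour
  split_ifs <;> simp

lemma signFour_eq_zero_of_even {s : ℤ} (h : Even s) : signFour s = 0 := by
  obtain ⟨k, rfl⟩ := h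
  rw [signFour, if_neg (by omega), if_neg (by omega)]

lemma symbolThree_eq (n : ℤ) :
    symbolThree n = if n % 3 = 1 then 1 else if n % 3 = 2 then -1 else 0 := rfl

lemma symbolThree_neg (n : ℤ) : symbolThree (-n) = -symbolThree n := by
  have h : n % 3 = 0 ∨ n % 3 = 1 ∨ n % 3 = 2 := by omega
  rw [symbolThree_eq, symbolThree_eq]
  rcases h with h | h | h
  · rw [h, show -n % 3 = 0 by omega]; norm_num
  · rw [h, show -n % 3 = 2 by omega]; norm_num
  · rw [h, show -n % 3 = 1 by omega]; norm_num

lemma symbolThree_mul_symbolThree (u v : ℤ) :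
    symbolThree v * symbolThree u =
      (if (3 : ℤ) ∣ v - u then 1 else 0) - (if (3 : ℤ) ∣ v + u then 1 else 0) := by
  have hu : u % 3 = 0 ∨ u % 3 = 1 ∨ u % 3 = 2 := by omega
  have hv : v % 3 = 0 ∨ v % 3 = 1 ∨ v % 3 = 2 := by omega
  have h1 : (3 : ℤ) ∣ v - u ↔ v % 3 = u % 3 := by omega
  have h2 : (3 : ℤ) ∣ v + u ↔ (v % 3 + u % 3) % 3 = 0 := by omega
  simp only [symbolThree_eq, h1, h2]
  rcases hu with hu | hu | hu <;> rcases hv with hv | hv | hv <;> simp [hu, hv]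

lemma norm_symbolThree_le_one (n : ℤ) : ‖(symbolThree n : ℂ)‖ ≤ 1 := by
  rw [symbolThree_eq]
  split_ifs <;> simp

lemma zpow_sq_eq_theta_term {X : ℂ} (hX : X ≠ 0) (n : ℤ) :
    X ^ (n ^ 2) = (-(-X)) ^ n * (X ^ 2) ^ (n * (n - 1) / 2) := by
  rw [neg_neg, ← zpow_natCast, ← zpow_mul, ← zpow_add₀ hX, Nat.cast_ofNat,
    two_mul_mul_pred_ediv_two]
  ring_nf

lemma summable_zpow_sq {X : ℂ} (hX : X ≠ 0) (hX1 : ‖X‖ < 1) :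
    Summable fun n : ℤ => X ^ (n ^ 2) := by
  simp_rw [zpow_sq_eq_theta_term hX]
  exact summable_theta (neg_ne_zero.mpr hX) (pow_ne_zero 2 hX) (norm_pow_lt_one hX1 two_ne_zero)

lemma summable_mul_zpow_sq {X : ℂ} (hX : X ≠ 0) (hX1 : ‖X‖ < 1) :
    Summable fun n : ℤ => (n : ℂ) * X ^ (n ^ 2) := by
  simp_rw [zpow_sq_eq_theta_term hX]
  exact summable_intCast_mul_theta (neg_ne_zero.mpr hX) (pow_ne_zero 2 hX)
    (norm_pow_lt_one hX1 two_ne_zero)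

lemma summable_mul_of_norm_le_one {c f : ℤ → ℂ} (hf : Summable f) (hc : ∀ n, ‖c n‖ ≤ 1) :
    Summable fun n => c n * f n := by
  refine Summable.of_norm_bounded hf.norm fun n => ?_
  rw [norm_mul]
  exact mul_le_of_le_one_left (norm_nonneg _) (hc n)

lemma qInf_one (Q : ℂ) (hQ1 : ‖Q‖ < 1) : qInf 1 Q = 0 := by
  rw [qInf_eq_prod 1 hQ1 one_pos, prod_range_one]
  refine tendsto_nhds_unique (tendsto_qFin _ (by simpa using hQ1)) (tendsto_const_nhds.congr' ?_)
  filter_upwards [eventually_gt_atTop 0] with N hN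
  exact (prod_eq_zero (mem_range.mpr hN) (by simp)).symm

/-- Jacobi's cube identity at Q = X^24, with s = 2n - 1 and s² = 1 + 8·n(n-1)/2. The part of s
without the factor n contributes the triple product at z = 1, which is 0. -/
lemma hasSum_signFour_mul {X : ℂ} (hX : X ≠ 0) (hX1 : ‖X‖ < 1) :
    HasSum (fun s : ℤ => signFour s * (s * (X ^ 3) ^ (s ^ 2)))
      (2 * X ^ 3 * eulerProd (X ^ 24) ^ 3) := by
  have hQ : X ^ 24 ≠ 0 := pow_ne_zero _ hX
  have hQ1 : ‖X ^ 24‖ < 1 := norm_pow_lt_one hX1 (by norm_num)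
  have hinj : Function.Injective fun n : ℤ => 2 * n - 1 := fun a b h => by
    dsimp only at h
    omega
  rw [← hinj.hasSum_iff]
  · have h1 := hasSum_jacobi_cube hQ hQ1
    have h2 := hasSum_jacobi_triple one_ne_zero hQ hQ1
    rw [qInf_one _ hQ1, zero_mul, mul_zero] at h2
    have h3 := (h2.sub (h1.mul_left 2)).mul_left (X ^ 3)
    rw [show 2 * X ^ 3 * eulerProd (X ^ 24) ^ 3 = X ^ 3 * (0 - 2 * -qInf (X ^ 24) (X ^ 24) ^ 3) by
      rw [eulerProd]; ring]
    refine h3.congr_fun fun n => ?_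
    have e1 : signFour (2 * n - 1) = -(-1) ^ n := by
      rw [show 2 * n - 1 = -1 + 2 * n by ring, signFour_add_two_mul]
      simp [signFour]
    have e2 : (X ^ 3) ^ ((2 * n - 1) ^ 2) = X ^ 3 * (X ^ 24) ^ (n * (n - 1) / 2) := by
      have h := two_mul_mul_pred_ediv_two n
      rw [show (2 * n - 1) ^ 2 = 1 + 8 * (n * (n - 1) / 2) by linarith, zpow_add₀ (by simpa),
        zpow_one, zpow_mul, show (X ^ 3) ^ (8 : ℤ) = X ^ 24 by norm_cast; ring]
    rw [Function.comp_apply, e1, e2]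
    push_cast
    ring
  · intro s hs
    rw [signFour_eq_zero_of_even, zero_mul]
    by_contra h
    obtain ⟨k, rfl⟩ := Int.not_even_iff_odd.mp h
    exact hs ⟨k + 1, by ring⟩

/-- The triple product at z = q, base q², where q = X^6. -/
lemma hasSum_neg_one_zpow_mul {X : ℂ} (hX : X ≠ 0) (hX1 : ‖X‖ < 1) :
    HasSum (fun t : ℤ => (-1) ^ t * (X ^ 6) ^ (t ^ 2))
      (eulerProd (X ^ 6) ^ 2 / eulerProd (X ^ 12)) := by
  have hq : X ^ 6 ≠ 0 := pow_ne_zero _ hX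
  have hq1 : ‖X ^ 6‖ < 1 := norm_pow_lt_one hX1 (by norm_num)
  have h := hasSum_jacobi_triple hq (pow_ne_zero 2 hq) (norm_pow_lt_one hq1 two_ne_zero)
  have e := qInf_sq_mul_eulerProd hq1
  have hE := eulerProd_ne_zero (norm_pow_lt_one hq1 two_ne_zero)
  have e2 : (X ^ 6) ^ 2 / X ^ 6 = X ^ 6 := by field_simp
  rw [show X ^ 12 = (X ^ 6) ^ 2 by ring]
  convert h using 1
  · ext t
    rw [zpow_sq_eq_theta_term hq, neg_neg, neg_eq_neg_one_mul (X ^ 6), mul_zpow]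
    ring
  · rw [e2, ← e]
    unfold eulerProd at *
    field_simp

/-- Negation exchanges the classes 1 and 5 modulo 6, so each carries half of the sum. -/
lemma hasSum_of_even_of_six {F : ℤ → ℂ} {S : ℂ} (heven : ∀ n, F (-n) = F n)
    (hsupp : ∀ n, n % 6 ≠ 1 → n % 6 ≠ 5 → F n = 0) (h : HasSum (fun n : ℤ => F (6 * n - 1)) S) :
    HasSum F (2 * S) := by
  have h1 : HasSum (fun n : ℤ => if n % 6 = 5 then F n else 0) S := by
    have hinj : Function.Injective fun n : ℤ => 6 * n - 1 := fun a b h => by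
      dsimp only at h
      omega
    rw [← hinj.hasSum_iff]
    · refine h.congr_fun fun n => ?_
      rw [Function.comp_apply, if_pos (by omega)]
    · intro n hn
      rw [if_neg]
      intro h5
      exact hn ⟨n / 6 + 1, by dsimp only; omega⟩
  have h2 := (Equiv.neg ℤ).hasSum_iff.mpr h1
  rw [two_mul]
  refine (h1.add h2).congr_fun fun n => ?_
  simp only [Function.comp_apply, Equiv.neg_apply, heven]
  by_cases h5 : n % 6 = 5
  · rw [if_pos h5, if_neg (by omega), add_zero]
  · by_cases h6 : n % 6 = 1
    · rw [if_neg h5, if_pos (by omega), zero_add]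
    · rw [if_neg h5, if_neg (by omega), hsupp n h6 h5, zero_add]

lemma eulerProd_eq_three {q : ℂ} (hq1 : ‖q‖ < 1) :
    qInf (q ^ 3) (q ^ 3) * (qInf q (q ^ 3) * qInf (q ^ 2) (q ^ 3)) = eulerProd q := by
  rw [eulerProd, qInf_eq_prod q hq1 (k := 3) (by norm_num)]
  simp only [prod_range_succ, prod_range_zero, one_mul]
  ring_nf

lemma signFour_neg (s : ℤ) : signFour (-s) = -signFour s := by
  have h : s % 4 = 0 ∨ s % 4 = 1 ∨ s % 4 = 2 ∨ s % 4 = 3 := by omega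
  rw [signFour, signFour]
  rcases h with h | h | h | h
  · rw [h, show -s % 4 = 0 by omega]; norm_num
  · rw [h, show -s % 4 = 3 by omega]; norm_num
  · rw [h, show -s % 4 = 2 by omega]; norm_num
  · rw [h, show -s % 4 = 1 by omega]; norm_num

/-- Euler's pentagonal number theorem as a sum over all integers. -/
lemma hasSum_signFour_mul_symbolThree {X : ℂ} (hX : X ≠ 0) (hX1 : ‖X‖ < 1) :
    HasSum (fun v : ℤ => signFour v * symbolThree v * X ^ (v ^ 2))
      (2 * (X * eulerProd (X ^ 24))) := by
  have hq : X ^ 24 ≠ 0 := pow_ne_zero _ hX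
  have hq1 : ‖X ^ 24‖ < 1 := norm_pow_lt_one hX1 (by norm_num)
  -- Chosen to match (6n-1)² = 1 + 24n + 72·n(n-1)/2.
  have h := hasSum_jacobi_triple hq (pow_ne_zero 3 hq) (norm_pow_lt_one hq1 three_ne_zero)
  rw [show (X ^ 24) ^ 3 / X ^ 24 = (X ^ 24) ^ 2 by field_simp, eulerProd_eq_three hq1] at h
  refine hasSum_of_even_of_six (fun n => ?_) (fun n h1 h5 => ?_)
    ((h.mul_left X).congr_fun fun n => ?_)
  · rw [signFour_neg, symbolThree_neg, neg_sq]
    push_cast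
    ring
  · by_cases hn : Even n
    · rw [signFour_eq_zero_of_even hn, zero_mul, zero_mul]
    · have := Int.not_even_iff.mp hn
      rw [symbolThree_eq, if_neg (by omega), if_neg (by omega)]
      simp
  · have e1 : signFour (6 * n - 1) = -(-1) ^ n := by
      rw [show 6 * n - 1 = -1 + 2 * n + 2 * (2 * n) by ring, signFour_add_two_mul,
        signFour_add_two_mul, (even_two_mul n).neg_one_zpow]
      simp [signFour]
    have e2 : X ^ ((6 * n - 1) ^ 2) =
        X * (X ^ 24) ^ n * ((X ^ 24) ^ 3) ^ (n * (n - 1) / 2) := by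
      have h := two_mul_mul_pred_ediv_two n
      rw [show (6 * n - 1) ^ 2 = 1 + 24 * n + 72 * (n * (n - 1) / 2) by linarith,
        zpow_add₀ hX, zpow_add₀ hX, zpow_one, zpow_mul, zpow_mul,
        show X ^ (72 : ℤ) = (X ^ 24) ^ 3 by norm_cast; ring]
      norm_cast
    rw [e1, e2, symbolThree_eq, if_neg (by omega), if_pos (by omega),
      neg_eq_neg_one_mul (X ^ 24), mul_zpow]
    push_cast
    ring

lemma hasSum_zero_of_odd {f : ℤ → ℂ} (hf : Summable f) (h : ∀ n, f (-n) = -f n) : HasSum f 0 := by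
  obtain ⟨S, hS⟩ := hf
  have h1 : HasSum f (-S) := ((Equiv.neg ℤ).hasSum_iff.mpr hS.neg).congr_fun fun n => by
    simp [h]
  have h2 : S = 0 := by
    have := hS.unique h1
    linear_combination this / 2
  rwa [h2] at hS

lemma hasSum_prod_mul {f g : ℤ → ℂ} {a b : ℂ} (hf : HasSum f a) (hg : HasSum g b) :
    HasSum (fun x : ℤ × ℤ => f x.1 * g x.2) (a * b) :=
  hf.mul hg (summable_mul_of_summable_norm hf.summable.norm hg.summable.norm)

/-! ### The lattice argument for the first identity. -/

/-- The map `(s, t) ↦ (s + 2 t, t - s)`, multiplication by an element of norm `3` in `ℤ[√-2]`. -/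
lemma hasSum_sublattice {X : ℂ} (hX : X ≠ 0) (hX1 : ‖X‖ < 1) :
    HasSum (fun c : ℤ × ℤ => if (3 : ℤ) ∣ c.1 + c.2 then
        -(signFour c.1 * X ^ (c.1 ^ 2) * (c.2 * (X ^ 2) ^ (c.2 ^ 2))) else 0)
      (2 * X ^ 3 * eulerProd (X ^ 24) ^ 3 * (eulerProd (X ^ 6) ^ 2 / eulerProd (X ^ 12))) := by
  have hX3 : ‖X ^ 3‖ < 1 := norm_pow_lt_one hX1 (by norm_num)
  have hX6 : ‖X ^ 6‖ < 1 := norm_pow_lt_one hX1 (by norm_num)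
  have hneg : ∀ t : ℤ, ‖(-1 : ℂ) ^ t‖ ≤ 1 := fun t => by simp
  have s1 := hasSum_signFour_mul hX hX1
  have s2 := hasSum_neg_one_zpow_mul hX hX1
  have s3 := (summable_mul_of_norm_le_one (summable_zpow_sq (pow_ne_zero 3 hX) hX3)
    norm_signFour_le_one).hasSum
  have s4 : HasSum (fun t : ℤ => (-1) ^ t * ((t : ℂ) * (X ^ 6) ^ (t ^ 2))) 0 :=
    hasSum_zero_of_odd (summable_mul_of_norm_le_one
      (summable_mul_zpow_sq (pow_ne_zero 6 hX) hX6) hneg) fun t => by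
        rw [neg_sq, zpow_neg, ← inv_zpow, inv_neg, inv_one]
        push_cast
        ring
  -- The weight -u = s - t splits the sum in two; the part with weight t vanishes by oddness.
  have s5 := (hasSum_prod_mul s1 s2).sub (hasSum_prod_mul s3 s4)
  rw [mul_zero, sub_zero] at s5
  have hinj : Function.Injective fun c : ℤ × ℤ => (c.1 + 2 * c.2, c.2 - c.1) := by
    rintro ⟨a, b⟩ ⟨c, d⟩ h
    simp only [Prod.mk.injEq] at h ⊢
    omega
  rw [← hinj.hasSum_iff]
  · refine s5.congr_fun fun c => ?_
    obtain ⟨s, t⟩ := c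
    rw [Function.comp_apply]
    dsimp only
    rw [if_pos ⟨t, by ring⟩, signFour_add_two_mul]
    have e : X ^ ((s + 2 * t) ^ 2) * (X ^ 2) ^ ((t - s) ^ 2) =
        (X ^ 3) ^ (s ^ 2) * (X ^ 6) ^ (t ^ 2) := by
      simp only [← zpow_natCast X, ← zpow_mul, ← zpow_add₀ hX]
      congr 1
      push_cast
      ring
    push_cast
    linear_combination (signFour s * (-1) ^ t * (s - t)) * e
  · rintro ⟨v, u⟩ hc
    rw [if_neg]
    rintro ⟨k, hk⟩
    dsimp only at hk
    -- If v + u = 3k, then t = k and s = k - u: the image is the whole sublattice.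
    exact hc ⟨(k - u, k), by simp only [Prod.mk.injEq]; omega⟩

lemma hasSum_mul_symbolThree_int {X : ℂ} (hX : X ≠ 0) (hX1 : ‖X‖ < 1) :
    HasSum (fun u : ℤ => (symbolThree u : ℂ) * (u * (X ^ 2) ^ (u ^ 2)))
      (2 * (X ^ 2 * (eulerProd (X ^ 6) ^ 2 * eulerProd (X ^ 24) ^ 2 / eulerProd (X ^ 12)))) := by
  obtain ⟨S, hS⟩ := summable_mul_of_norm_le_one (summable_mul_zpow_sq (pow_ne_zero 2 hX)
    (norm_pow_lt_one hX1 two_ne_zero)) norm_symbolThree_le_one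
  have h1 := hasSum_sublattice hX hX1
  -- Reflecting u gives the sublattice 3 ∣ v - u; the weight changes sign, so the two contributions
  -- add.
  have h2 := ((Equiv.refl ℤ).prodCongr (Equiv.neg ℤ)).hasSum_iff.mpr h1
  have h3 := (hasSum_signFour_mul_symbolThree hX hX1).mul_eq hS
    ((h1.add h2).congr_fun fun ⟨v, u⟩ => ?_)
  · have n24 := eulerProd_ne_zero (norm_pow_lt_one hX1 (k := 24) (by norm_num))
    have n12 := eulerProd_ne_zero (norm_pow_lt_one hX1 (k := 12) (by norm_num))
    convert hS using 1
    apply mul_left_cancel₀ (mul_ne_zero two_ne_zero (mul_ne_zero hX n24))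
    rw [h3]
    field_simp
    ring
  · simp only [Function.comp_apply, Equiv.prodCongr_apply, Prod.map_apply, Equiv.refl_apply,
      Equiv.neg_apply, neg_sq, ← sub_eq_add_neg]
    have e := congrArg (Int.cast : ℤ → ℂ) (symbolThree_mul_symbolThree u v)
    push_cast at e
    have e' : ∀ p : Prop, [Decidable p] → ∀ z : ℂ, (if p then z else 0) = (if p then 1 else 0) * z :=
      fun p _ z => by split_ifs <;> simp
    rw [e' (3 ∣ v + u), e' (3 ∣ v - u)]
    push_cast
    linear_combination (signFour v * X ^ (v ^ 2) * (u * (X ^ 2) ^ (u ^ 2))) * e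

/-- Both u and (u/3) are odd, so u and -u contribute equally, and u = 0 contributes nothing. -/
lemma hasSum_mul_symbolThree_pnat {X : ℂ} (hX : X ≠ 0) (hX1 : ‖X‖ < 1) :
    HasSum (fun n : ℕ+ => ((n : ℕ) : ℂ) * (symbolThree ((n : ℕ) : ℤ) : ℂ) * X ^ (2 * (n : ℕ) ^ 2))
      (X ^ 2 * (eulerProd (X ^ 6) ^ 2 * eulerProd (X ^ 24) ^ 2 / eulerProd (X ^ 12))) := by
  have h := ((hasSum_mul_symbolThree_int hX hX1).nat_add_neg).div_const 2
  rw [hasSum_pnat_iff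
    (f := fun n : ℕ => (n : ℂ) * (symbolThree (n : ℤ) : ℂ) * X ^ (2 * n ^ 2))]
  have hv (z : ℂ) : z + ((0 : ℕ) : ℂ) * (symbolThree ((0 : ℕ) : ℤ) : ℂ) * X ^ (2 * 0 ^ 2) =
      (2 * z + symbolThree 0 * (((0 : ℤ) : ℂ) * (X ^ 2) ^ ((0 : ℤ) ^ 2))) / 2 := by
    simp
  rw [hv]
  refine h.congr_fun fun n => ?_
  rw [symbolThree_neg, neg_sq, ← Nat.cast_pow, zpow_natCast, pow_mul]
  push_cast
  ring

/-! ### Translation to eta quotients. -/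

theorem mainTheorem6 (τ : ℂ) (hτ : 0 < τ.im) :
    HasSum
      (fun n : ℕ+ => ((n : ℕ) : ℂ) * (symbolThree ((n : ℕ) : ℤ) : ℂ) *
        Complex.exp (2 * (Real.pi : ℂ) * Complex.I * ((n : ℕ) : ℂ) ^ 2 * τ / 3))
      (ModularForm.eta τ ^ 2 * ModularForm.eta (4 * τ) ^ 2 / ModularForm.eta (2 * τ)) ∧
    HasSum
      (fun n : ℕ+ =>
        ((dStar 1 6 n : ℂ) + (dStar 2 6 n : ℂ) - (dStar 4 6 n : ℂ) - (dStar 5 6 n : ℂ)) *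
          Complex.exp (2 * (Real.pi : ℂ) * Complex.I * τ) ^ (n : ℕ))
      (ModularForm.eta (2 * τ) * ModularForm.eta (3 * τ) ^ 3 * ModularForm.eta (12 * τ) ^ 3 /
        (ModularForm.eta τ * ModularForm.eta (4 * τ) * ModularForm.eta (6 * τ) ^ 3)) := by
  set r := Complex.exp (2 * Real.pi * Complex.I * τ / 24) with hr
  set q := Complex.exp (2 * Real.pi * Complex.I * τ) with hq
  have hr0 : r ≠ 0 := Complex.exp_ne_zero _
  have hrq : r ^ 24 = q := by
    rw [hr, hq, ← Complex.exp_nat_mul]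
    congr 1
    push_cast
    ring
  have hr1 : ‖r‖ < 1 := by
    rw [hr, Complex.norm_exp, Real.exp_lt_one_iff]
    have : (2 * Real.pi * Complex.I * τ / 24).re = -(2 * Real.pi * τ.im / 24) := by
      simp
      ring
    rw [this]
    have := Real.pi_pos
    have : 0 < 2 * Real.pi * τ.im / 24 := by positivity
    linarith
  have hq1 : ‖q‖ < 1 := hrq ▸ norm_pow_lt_one hr1 (by norm_num)
  have hq0 : q ≠ 0 := Complex.exp_ne_zero _
  have h1 := eta_natCast_mul τ 1
  have h2 := eta_natCast_mul τ 2
  have h3 := eta_natCast_mul τ 3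
  have h4 := eta_natCast_mul τ 4
  have h6 := eta_natCast_mul τ 6
  have h12 := eta_natCast_mul τ 12
  rw [← hr, ← hq] at h1 h2 h3 h4 h6 h12
  push_cast at h1 h2 h3 h4 h6 h12
  rw [one_mul, pow_one, pow_one] at h1
  rw [h1, h2, h3, h4, h6, h12]
  constructor
  -- X = r⁴ makes X⁶ = q and X² = e^{2πiτ/3}; the eta prefactors combine to r⁸ = X².
  · have h := hasSum_mul_symbolThree_pnat (pow_ne_zero 4 hr0)
      (norm_pow_lt_one hr1 (k := 4) (by norm_num))
    have e1 : (r ^ 4) ^ 6 = q := by rw [← hrq]; ring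
    have e2 : (r ^ 4) ^ 12 = q ^ 2 := by rw [← hrq]; ring
    have e4 : (r ^ 4) ^ 24 = q ^ 4 := by rw [← hrq]; ring
    rw [e1, e2, e4] at h
    have hv : (r * eulerProd q) ^ 2 * (r ^ 4 * eulerProd (q ^ 4)) ^ 2 /
        (r ^ 2 * eulerProd (q ^ 2)) =
        (r ^ 4) ^ 2 * (eulerProd q ^ 2 * eulerProd (q ^ 4) ^ 2 / eulerProd (q ^ 2)) := by
      have := eulerProd_ne_zero (norm_pow_lt_one hq1 two_ne_zero)
      field_simp
    rw [hv]
    refine h.congr_fun fun n => ?_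
    rw [← pow_mul, hr, ← Complex.exp_nat_mul]
    congr 2
    push_cast
    ring
  · have h := hasSum_dStar hq0 hq1
    have hv : r ^ 2 * eulerProd (q ^ 2) * (r ^ 3 * eulerProd (q ^ 3)) ^ 3 *
        (r ^ 12 * eulerProd (q ^ 12)) ^ 3 /
        (r * eulerProd q * (r ^ 4 * eulerProd (q ^ 4)) * (r ^ 6 * eulerProd (q ^ 6)) ^ 3) =
        q * (eulerProd (q ^ 2) * eulerProd (q ^ 3) ^ 3 * eulerProd (q ^ 12) ^ 3 /
        (eulerProd q * eulerProd (q ^ 4) * eulerProd (q ^ 6) ^ 3)) := by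
      field_simp
      -- The eta prefactors leave r^(47-23) = r^24 = q.
      rw [hrq]
    rw [hv]
    exact h
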